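/- Fix constants $\alpha_i,\epsilon_i>0$ ($i=1,\dots,n$) and independent standard scalar Brownian motions $W_1,\dots,W_n$ on a probability space. For each $i$ let $X_i$ be the Ornstein–Uhlenbeck process, i.e. the continuous solution of $$dX_i(t)=-\alpha_iX_i(t)\,dt+\epsilon_i\,dW_i(t),\qquad X_i(0)=0,$$ and define the skew and the time display of clock $i$ at time $t\in\mathbb{R}_+$ by $$a_i(t):=c_i(t)\,e^{X_i(t)},\qquad c_i(t):=e^{-\frac14\frac{\epsilon_i^2}{\alpha_i}\left(1-e^{-2\alpha_it}\right)},\qquad \tau_i(t):=\int_0^t a_i(s)\,ds .$$ Then for each clock $i=1,\dots,n$: 1. The skew is square integrable, $\mathbb{E}[a_i(t)]=1$ for all $t\in\mathbb{R}_+$, and $\sup_{t\in\mathbb{R}_+}\mathrm{Var}(a_i(t))<+\infty$. 2. Almost surely the integral defining $\tau_i(t)$ exists for all $t$; the time display is square integrable, $\mathbb{E}[\tau_i(t)]=t$ for all $t\in\mathbb{R}_+$, and $\lim_{t\to+\infty}\mathrm{Var}(\tau_i(t))=+\infty$; in particular, $\mathrm{Var}(\tau_i(t))=\Omega(t)$ and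 $\mathrm{Var}(\tau_i(t))=O(t^2)$ as $t\to+\infty$. -/

import Mathlib

open MeasureTheory ProbabilityTheory Filter Asymptotics Topology
open scoped NNReal

noncomputable section

namespace ClockModel

variable {Ω : Type*} [MeasurableSpace Ω]

/-- `X` is an Ornstein-Uhlenbeck process driven by `W`, that is, a solution with almost surely
continuous paths of the stochastic differential equation `dX(t) = -α X(t) dt + ε dW(t)` with
`X(0) = 0`. The diffusion coefficient is constant, so the stochastic integral of `ε` against `W`
over `[0, t]` is `ε (W(t) - W(0))`, and the integral form of the equation is pathwise. -/
structure IsOrnsteinUhlenbeck (P : Measure Ω) (α ε : ℝ) (W X : ℝ≥0 → Ω → ℝ) : Prop where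
  cont : ∀ᵐ ω ∂P, Continuous fun t : ℝ≥0 => X t ω
  init : ∀ᵐ ω ∂P, X 0 ω = 0
  sde : ∀ᵐ ω ∂P, ∀ t : ℝ≥0,
    X t ω - X 0 ω = -α * (∫ s in (0 : ℝ)..(t : ℝ), X s.toNNReal ω) + ε * (W t ω - W 0 ω)

/-- The data behind `n` (non-reference) clocks: constants `α i, ε i > 0`, independent standard
Brownian motions `W i`, and the Ornstein-Uhlenbeck processes `X i` that they drive. -/
structure IsClockNetwork (P : Measure Ω) {n : ℕ} (α ε : Fin n → ℝ)
    (W X : Fin n → ℝ≥0 → Ω → ℝ) : Prop where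
  alpha_pos : ∀ i, 0 < α i
  eps_pos : ∀ i, 0 < ε i
  brownian : ∀ i, IsBrownianReal (W i) P
  indep : iIndepFun (fun i ω (t : ℝ≥0) => W i t ω) P
  ou : ∀ i, IsOrnsteinUhlenbeck P (α i) (ε i) (W i) (X i)

/-- The normalizing factor `c(t) = exp (-(1/4) (ε² / α) (1 - e^{-2 α t}))`. -/
def normFactor (α ε : ℝ) (t : ℝ≥0) : ℝ :=
  Real.exp (-(1 / 4) * (ε ^ 2 / α) * (1 - Real.exp (-2 * α * t)))

/-- The skew `a(t) = c(t) e^{X(t)}` of a clock. -/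
def skew (α ε : ℝ) (X : ℝ≥0 → Ω → ℝ) (t : ℝ≥0) (ω : Ω) : ℝ :=
  normFactor α ε t * Real.exp (X t ω)

/-- The display `τ(t) = ∫₀ᵗ a(s) ds` of a clock. -/
def display (α ε : ℝ) (X : ℝ≥0 → Ω → ℝ) (t : ℝ≥0) (ω : Ω) : ℝ :=
  ∫ s in (0 : ℝ)..(t : ℝ), skew α ε X s.toNNReal ω

end ClockModel

end

/-! Everything follows from the identity E[a(s) a(t)] = exp(K(s, t)), where K is the covariance
function `ouCov` of the centered Gaussian process X: since c(t) = exp(-K(t, t)/2), the factors c(s),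
c(t) cancel the diagonal terms in the Gaussian exponential moment of X(s) + X(t)
(`integrable_skew_mul_skew`). Because 0 ≤ K ≤ ε²/(2α), the skew has bounded variance, and K(0, t) =
0 gives its mean.

By Fubini, E[τ(t)] = t and E[τ(t)²] is the double integral of e^K over (0, t]². Bounding e^K by
exp(ε²/(2α)) gives the O(t²) bound; e^K ≥ 1 + K reduces the lower bound to the double integral of K,
which grows linearly because K(s, ·) has mass close to ε²/α² for s far from the endpoints, and at
least about half of it on (0, s] alone (`le_integral_exp_ouCov`).

The law of X(s) + X(t) is obtained without stochastic integration. Variation of constants, applied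
pathwise, writes X(t) as ε e^{-αt} times the integral of e^{αu} dW(u), understood through
integration by parts. Its Riemann-Stieltjes sums are combinations of disjoint Brownian increments,
hence Gaussian, and they converge almost surely (`hasLaw_expWiener_add`). -/

/-- An almost sure limit of centered real Gaussian variables whose variances converge is a centered
Gaussian variable. -/
lemma hasLaw_gaussianReal_of_tendsto_ae {Ω : Type*} [MeasurableSpace Ω] {P : Measure Ω}
    [IsProbabilityMeasure P] {G : ℕ → Ω → ℝ} {Z : Ω → ℝ} {v : ℕ → ℝ≥0} {v₀ : ℝ≥0}
    (hG : ∀ n, HasLaw (G n) (gaussianReal 0 (v n)) P)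
    (hlim : ∀ᵐ ω ∂P, Tendsto (fun n => G n ω) atTop (𝓝 (Z ω)))
    (hv : Tendsto v atTop (𝓝 v₀)) : HasLaw Z (gaussianReal 0 v₀) P := by
  have hZ : AEMeasurable Z P := aemeasurable_of_tendsto_metrizable_ae' (fun n => (hG n).aemeasurable) hlim
  refine ⟨hZ, ?_⟩
  have : IsProbabilityMeasure (P.map Z) := Measure.isProbabilityMeasure_map hZ
  refine Measure.ext_of_charFun (funext fun ξ => ?_)
  have key : ∀ {Y : Ω → ℝ}, AEMeasurable Y P →
      charFun (P.map Y) ξ = ∫ ω, Complex.exp (ξ * Y ω * Complex.I) ∂P := fun {Y} hY => by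
    rw [charFun_apply_real, integral_map hY]
    exact Measurable.aestronglyMeasurable (by fun_prop)
  have h1 : Tendsto (fun n => charFun (P.map (G n)) ξ) atTop (𝓝 (charFun (P.map Z) ξ)) := by
    simp_rw [key hZ, fun n => key (hG n).aemeasurable]
    refine tendsto_integral_of_dominated_convergence (fun _ => 1) (fun n => ?_)
      (integrable_const _) (fun n => ae_of_all _ fun ω => ?_) ?_
    · have := (hG n).aemeasurable
      exact AEMeasurable.aestronglyMeasurable (by fun_prop)
    · rw [← Complex.ofReal_mul, Complex.norm_exp_ofReal_mul_I]
    · filter_upwards [hlim] with ω hω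
      have hc : Continuous fun x : ℝ => Complex.exp (ξ * x * Complex.I) := by fun_prop
      exact (hc.tendsto _).comp hω
  have h2 : Tendsto (fun n => charFun (P.map (G n)) ξ) atTop
      (𝓝 (charFun (gaussianReal 0 v₀) ξ)) := by
    simp_rw [fun n => (hG n).map_eq, charFun_gaussianReal]
    have hc : Continuous fun x : ℝ≥0 =>
        Complex.exp (ξ * (0 : ℝ) * Complex.I - (x : ℝ) * ξ ^ 2 / 2) := by fun_prop
    exact (hc.tendsto _).comp hv
  exact tendsto_nhds_unique h1 h2

/-- The law of a linear combination of increments of a Brownian motion over pairwise non-overlapping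
intervals. -/
lemma hasLaw_sum_increments {Ω : Type*} [MeasurableSpace Ω] {P : Measure Ω} {W : ℝ≥0 → Ω → ℝ}
    (hW : IsPreBrownianReal W P) {ι : Type*} [Fintype ι] (c : ι → ℝ) (a b : ι → ℝ≥0)
    (hab : ∀ i, a i ≤ b i) (hd : ∀ i j, i ≠ j → b i ≤ a j ∨ b j ≤ a i) :
    HasLaw (fun ω => ∑ i, c i * (W (b i) ω - W (a i) ω))
      (gaussianReal 0 (∑ i, c i ^ 2 * ((b i : ℝ) - a i)).toNNReal) P := by
  classical
  have hP : IsProbabilityMeasure P := hW.isGaussianProcess.isProbabilityMeasure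
  have hgp : IsGaussianProcess (fun i ω => c i * (W (b i) ω - W (a i) ω)) P :=
    hW.isGaussianProcess.of_isGaussianProcess fun i => ⟨{a i, b i},
      { toFun x := c i * (x ⟨b i, by simp⟩ - x ⟨a i, by simp⟩)
        map_add' x y := by simp; ring
        map_smul' m x := by simp; ring }, by simp⟩
  have hL2 : ∀ i, MemLp (W i) 2 P := fun i => (hW.isGaussianProcess.hasGaussianLaw_eval i).memLp_two
  have hI : ∀ i, MemLp (fun ω => c i * (W (b i) ω - W (a i) ω)) 2 P :=
    fun i => (hgp.hasGaussianLaw_eval i).memLp_two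
  have hg : HasGaussianLaw (fun ω => ∑ i, c i * (W (b i) ω - W (a i) ω)) P :=
    hgp.hasGaussianLaw_fun_sum (I := Finset.univ)
  refine ⟨hg.aemeasurable, ?_⟩
  rw [hg.map_eq_gaussianReal]
  congr 2
  · rw [integral_finsetSum _ fun i _ => (hI i).integrable (by norm_num)]
    refine Finset.sum_eq_zero fun i _ => ?_
    rw [integral_const_mul, integral_sub (hW.integrable_eval _) (hW.integrable_eval _),
      hW.integral_eval, hW.integral_eval]
    simp
  · rw [variance_fun_sum hI]
    refine Finset.sum_congr rfl fun i _ => ?_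
    have hcov : ∀ j, cov[fun ω => c i * (W (b i) ω - W (a i) ω),
        fun ω => c j * (W (b j) ω - W (a j) ω); P] =
        c i * (c j * ((min (b i) (b j) : ℝ≥0) - (min (b i) (a j) : ℝ≥0)
          - ((min (a i) (b j) : ℝ≥0) - (min (a i) (a j) : ℝ≥0)))) := fun j => by
      rw [covariance_const_mul_left, covariance_const_mul_right,
        covariance_fun_sub_fun_sub (hL2 _) (hL2 _) (hL2 _) (hL2 _)]
      simp_rw [hW.covariance_fun_eval]
      ring
    -- Disjoint increments are uncorrelated: each ordering of the two intervals makes the four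
    -- minima cancel.
    rw [Finset.sum_eq_single i]
    · rw [hcov, min_self, min_self, min_eq_right (hab i), min_eq_left (hab i)]
      ring
    · intro j _ hj
      rw [hcov]
      have hi := hab i
      have hj' := hab j
      rcases hd i j hj.symm with h | h
      · rw [min_eq_left (h.trans hj'), min_eq_left h, min_eq_left ((hi.trans h).trans hj'),
          min_eq_left (hi.trans h)]
        ring
      · rw [min_eq_right (h.trans hi), min_eq_right ((hj'.trans h).trans hi), min_eq_right h,
          min_eq_right (hj'.trans h)]
        ring
    · simp

/-! ### Riemann-Stieltjes sums and pathwise variation of constants -/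

/-- The `k`-th point of the uniform partition of `[a, b]` into `n` intervals. -/
noncomputable def partitionPoint (a b : ℝ) (n k : ℕ) : ℝ := a + k * ((b - a) / n)

lemma partitionPoint_mono {a b : ℝ} (hab : a ≤ b) (n : ℕ) : Monotone (partitionPoint a b n) := by
  intro k l hkl
  have : (k : ℝ) ≤ l := by exact_mod_cast hkl
  have : 0 ≤ (b - a) / n := div_nonneg (by linarith) (by positivity)
  unfold partitionPoint
  gcongr

lemma partitionPoint_zero (a b : ℝ) (n : ℕ) : partitionPoint a b n 0 = a := by
  simp [partitionPoint]

lemma partitionPoint_self (a b : ℝ) {n : ℕ} (hn : n ≠ 0) : partitionPoint a b n n = b := by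
  unfold partitionPoint
  field_simp
  ring

/-- Left Riemann-Stieltjes sums of a `C¹` function against a continuous function converge, to the
value that integration by parts gives. -/
lemma tendsto_sum_mul_increments {f f' w : ℝ → ℝ} (hf : ∀ u, HasDerivAt f (f' u) u)
    (hf' : Continuous f') (hw : Continuous w) {a b : ℝ} (hab : a ≤ b) :
    Tendsto (fun n : ℕ => ∑ k : Fin n, f (partitionPoint a b n k) *
        (w (partitionPoint a b n (k + 1)) - w (partitionPoint a b n k))) atTop
      (𝓝 (f b * w b - f a * w a - ∫ u in a..b, f' u * w u)) := by
  have hii : ∀ x y : ℝ, IntervalIntegrable f' volume x y := fun x y => hf'.intervalIntegrable x y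
  obtain ⟨C, hC⟩ := (isCompact_Icc (a := a) (b := b)).exists_bound_of_continuousOn hf'.continuousOn
  have hC0 : 0 ≤ C := (norm_nonneg _).trans (hC a ⟨le_rfl, hab⟩)
  rw [Metric.tendsto_atTop]
  intro e he
  -- The total error will be at most η C (b - a); the added 1 keeps the denominator positive and the
  -- final inequality strict.
  set η : ℝ := e / (C * (b - a) + 1) with hη
  have hden : 0 < C * (b - a) + 1 := by nlinarith
  have hη0 : 0 < η := div_pos he hden
  have huc := (isCompact_Icc (a := a) (b := b)).uniformContinuousOn_of_continuous hw.continuousOn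
  rw [Metric.uniformContinuousOn_iff] at huc
  obtain ⟨δ, hδ, hwδ⟩ := huc η hη0
  obtain ⟨N, hN⟩ := exists_nat_gt ((b - a) / δ)
  refine ⟨N + 1, fun n hn => ?_⟩
  have hn0 : n ≠ 0 := by omega
  have hnpos : (0 : ℝ) < n := by positivity
  have hNn : (N : ℝ) ≤ n := by exact_mod_cast (by omega : N ≤ n)
  have hmesh : (b - a) / n < δ := by
    rw [div_lt_iff₀ hnpos]
    rw [div_lt_iff₀ hδ] at hN
    nlinarith
  set u := partitionPoint a b n with hu
  have hmono : Monotone u := partitionPoint_mono hab n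
  have hu0 : u 0 = a := partitionPoint_zero a b n
  have hun : u n = b := partitionPoint_self a b hn0
  have hstep : ∀ k, u (k + 1) - u k = (b - a) / n := fun k => by
    simp only [hu, partitionPoint]; push_cast; ring
  have hmem : ∀ k, k ≤ n → u k ∈ Set.Icc a b := fun k hk =>
    ⟨hu0 ▸ hmono (Nat.zero_le k), hun ▸ hmono hk⟩
  rw [Fin.sum_univ_eq_sum_range (fun k => f (u k) * (w (u (k + 1)) - w (u k))) n]
  have hint : ∫ x in a..b, f' x * w x = ∑ k ∈ Finset.range n, ∫ x in u k..u (k + 1), f' x * w x := by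
    rw [intervalIntegral.sum_integral_adjacent_intervals (f := fun x => f' x * w x) (a := u)
      fun k _ => (hf'.mul hw).intervalIntegrable _ _, hu0, hun]
  have htel : f b * w b - f a * w a =
      ∑ k ∈ Finset.range n, (f (u (k + 1)) * w (u (k + 1)) - f (u k) * w (u k)) := by
    rw [Finset.sum_range_sub (fun k => f (u k) * w (u k)), hu0, hun]
  -- On each cell, integration by parts leaves only the integral of f' against the oscillation of w.
  have hterm : ∀ k, f (u k) * (w (u (k + 1)) - w (u k)) -
      ((f (u (k + 1)) * w (u (k + 1)) - f (u k) * w (u k)) - ∫ x in u k..u (k + 1), f' x * w x) =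
      ∫ x in u k..u (k + 1), f' x * (w x - w (u (k + 1))) := fun k => by
    have h1 : ∫ x in u k..u (k + 1), f' x = f (u (k + 1)) - f (u k) :=
      intervalIntegral.integral_eq_sub_of_hasDerivAt (fun x _ => hf x) (hii _ _)
    simp_rw [mul_sub]
    have h2 : IntervalIntegrable (fun x => f' x * w x) volume (u k) (u (k + 1)) :=
      (hf'.mul hw).intervalIntegrable _ _
    rw [intervalIntegral.integral_sub h2 ((hii _ _).mul_const _),
      intervalIntegral.integral_mul_const, h1]
    ring
  rw [dist_eq_norm, hint, htel, ← Finset.sum_sub_distrib, ← Finset.sum_sub_distrib,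
    Finset.sum_congr rfl fun k _ => hterm k]
  have hbound : ∀ k ∈ Finset.range n, ‖∫ x in u k..u (k + 1), f' x * (w x - w (u (k + 1)))‖ ≤
      C * η * ((b - a) / n) := fun k hk => by
    have hkn := Finset.mem_range.mp hk
    have hle : u k ≤ u (k + 1) := hmono (Nat.le_succ k)
    have hk1 := hmem (k + 1) hkn
    have hk0 := hmem k hkn.le
    refine (intervalIntegral.norm_integral_le_of_norm_le_const (C := C * η) fun x hx => ?_).trans
      (by rw [abs_of_nonneg (by linarith), hstep])
    rw [Set.uIoc_of_le hle] at hx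
    have hxm : x ∈ Set.Icc a b := ⟨hk0.1.trans hx.1.le, hx.2.trans hk1.2⟩
    rw [norm_mul]
    refine mul_le_mul (hC x hxm) ?_ (norm_nonneg _) hC0
    refine (hwδ x hxm _ hk1 ?_).le
    rw [Real.dist_eq, abs_sub_comm, abs_of_nonneg (by linarith [hx.2])]
    linarith [hstep k, hx.1]
  refine ((norm_sum_le _ _).trans (Finset.sum_le_sum hbound)).trans_lt ?_
  rw [Finset.sum_const, Finset.card_range, nsmul_eq_mul]
  have : (n : ℝ) * (C * η * ((b - a) / n)) = η * (C * (b - a)) := by field_simp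
  rw [this]
  have : η * (C * (b - a) + 1) = e := by rw [hη]; field_simp
  nlinarith

lemma hasDerivAt_exp_mul (α u : ℝ) :
    HasDerivAt (fun u => Real.exp (α * u)) (α * Real.exp (α * u)) u := by
  simpa [mul_comm] using ((hasDerivAt_id u).const_mul α).exp

/-- The integral form of a linear equation driven by a continuous path is solved by the variation of
constants formula. -/
lemma eq_variation_of_constants {x w : ℝ → ℝ} (hx : Continuous x) (hw : Continuous w) {α ε t : ℝ}
    (ht : 0 ≤ t) (h : ∀ u, 0 ≤ u → x u = -α * (∫ s in (0 : ℝ)..u, x s) + ε * w u) :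
    x t = ε * Real.exp (-α * t) *
      (Real.exp (α * t) * w t - ∫ u in (0 : ℝ)..t, α * Real.exp (α * u) * w u) := by
  have hF : ∀ u, HasDerivAt (fun u => ∫ s in (0 : ℝ)..u, x s) (x u) u := fun u =>
    intervalIntegral.integral_hasDerivAt_right (hx.intervalIntegrable _ _)
      (hx.stronglyMeasurableAtFilter _ _) hx.continuousAt
  -- Integrating factor: by the equation, e^{αu} times the primitive of x has derivative ε e^{αu}
  -- w(u).
  have h1 : ∫ u in (0 : ℝ)..t, ε * Real.exp (α * u) * w u =
      Real.exp (α * t) * ∫ s in (0 : ℝ)..t, x s := by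
    rw [intervalIntegral.integral_eq_sub_of_hasDerivAt
      (f := fun u => Real.exp (α * u) * ∫ s in (0 : ℝ)..u, x s)]
    · simp
    · intro u hu
      rw [Set.uIcc_of_le ht] at hu
      refine ((hasDerivAt_exp_mul α u).mul (hF u)).congr_deriv ?_
      rw [h u hu.1]
      ring
    · exact Continuous.intervalIntegrable (by fun_prop) _ _
  have h2 : ε * ∫ u in (0 : ℝ)..t, α * Real.exp (α * u) * w u =
      α * ∫ u in (0 : ℝ)..t, ε * Real.exp (α * u) * w u := by
    rw [← intervalIntegral.integral_const_mul, ← intervalIntegral.integral_const_mul]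
    congr 1
    ext u
    ring
  have h3 : Real.exp (-α * t) * Real.exp (α * t) = 1 := by rw [← Real.exp_add]; simp
  rw [h t ht]
  linear_combination Real.exp (-α * t) * (h2 + α * h1) +
    (α * (∫ s in (0 : ℝ)..t, x s) - ε * w t) * h3

/-! ### The Ornstein-Uhlenbeck covariance -/

namespace ClockModel

/-- The covariance function of the Ornstein-Uhlenbeck process started at `0`. -/
noncomputable def ouCov (α ε s t : ℝ) : ℝ :=
  ε ^ 2 / (2 * α) * (Real.exp (-α * |t - s|) - Real.exp (-α * (t + s)))

lemma ouCov_comm (α ε s t : ℝ) : ouCov α ε s t = ouCov α ε t s := by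
  rw [ouCov, ouCov, abs_sub_comm, add_comm]

lemma ouCov_nonneg {α : ℝ} (hα : 0 < α) (ε : ℝ) {s t : ℝ} (hs : 0 ≤ s) (ht : 0 ≤ t) :
    0 ≤ ouCov α ε s t := by
  have h : |t - s| ≤ t + s := abs_le.mpr ⟨by linarith, by linarith⟩
  have : Real.exp (-α * (t + s)) ≤ Real.exp (-α * |t - s|) := Real.exp_le_exp.mpr (by nlinarith)
  exact mul_nonneg (by positivity) (by linarith)

lemma ouCov_le {α : ℝ} (hα : 0 < α) (ε s t : ℝ) : ouCov α ε s t ≤ ε ^ 2 / (2 * α) := by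
  have h1 : Real.exp (-α * |t - s|) ≤ 1 :=
    Real.exp_le_one_iff.mpr (by nlinarith [abs_nonneg (t - s)])
  have h2 := Real.exp_pos (-α * (t + s))
  exact mul_le_of_le_one_right (by positivity) (by linarith)

lemma continuous_ouCov (α ε : ℝ) : Continuous fun z : ℝ × ℝ => ouCov α ε z.1 z.2 := by
  unfold ouCov
  fun_prop

lemma normFactor_eq {α : ℝ} (hα : 0 < α) (ε : ℝ) (t : ℝ≥0) :
    normFactor α ε t = Real.exp (-ouCov α ε t t / 2) := by
  rw [normFactor, ouCov, sub_self, abs_zero, mul_zero, Real.exp_zero,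
    show -α * ((t : ℝ) + t) = -2 * α * t by ring]
  congr 1
  field_simp
  ring

variable {Ω : Type*} {W X : ℝ≥0 → Ω → ℝ} {α ε : ℝ}

/-! ### Wiener integrals and their Gaussian laws -/

/-- The Wiener integral `∫ e^{αu} dW(u)` over `[a, b]`, written through integration by parts. -/
noncomputable def expWiener (α : ℝ) (W : ℝ≥0 → Ω → ℝ) (a b : ℝ≥0) (ω : Ω) : ℝ :=
  Real.exp (α * b) * W b ω - Real.exp (α * a) * W a ω -
    ∫ u in (a : ℝ)..b, α * Real.exp (α * u) * W u.toNNReal ω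

lemma tendsto_sum_exp_increments {ω : Ω} (hW : Continuous fun t => W t ω) (α : ℝ) {a b : ℝ≥0}
    (hab : a ≤ b) :
    Tendsto (fun n : ℕ => ∑ k : Fin n, Real.exp (α * partitionPoint a b n k) *
      (W (partitionPoint a b n (k + 1)).toNNReal ω - W (partitionPoint a b n k).toNNReal ω))
      atTop (𝓝 (expWiener α W a b ω)) := by
  have := tendsto_sum_mul_increments (w := fun u => W u.toNNReal ω) (hasDerivAt_exp_mul α)
    (by fun_prop) (hW.comp continuous_real_toNNReal) (NNReal.coe_le_coe.mpr hab)
  simpa [expWiener] using this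

/-- These sums are the variances of the Riemann-Stieltjes sums of e^{αu} dW(u); the limit is the
integral of e^{2αu}, as in the Itô isometry. -/
lemma tendsto_sum_exp_sq (hα : 0 < α) {a b : ℝ} (hab : a ≤ b) :
    Tendsto (fun n : ℕ => ∑ k : Fin n, Real.exp (α * partitionPoint a b n k) ^ 2 *
      (partitionPoint a b n (k + 1) - partitionPoint a b n k)) atTop
      (𝓝 ((Real.exp (2 * α * b) - Real.exp (2 * α * a)) / (2 * α))) := by
  have h := tendsto_sum_mul_increments (w := id) (hasDerivAt_exp_mul (2 * α)) (by fun_prop)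
    continuous_id hab
  have hsq : ∀ x : ℝ, Real.exp (α * x) ^ 2 = Real.exp (2 * α * x) := fun x => by
    rw [sq, ← Real.exp_add]; ring_nf
  simp_rw [hsq]
  convert! h using 2
  have hd : ∀ u : ℝ, HasDerivAt
      (fun u => Real.exp (2 * α * u) * u - Real.exp (2 * α * u) / (2 * α))
      (2 * α * Real.exp (2 * α * u) * id u) u := fun u => by
    refine (((hasDerivAt_exp_mul (2 * α) u).mul (hasDerivAt_id u)).sub
      ((hasDerivAt_exp_mul (2 * α) u).div_const (2 * α))).congr_deriv ?_
    simp only [id]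
    field_simp
    ring
  rw [intervalIntegral.integral_eq_sub_of_hasDerivAt (fun u _ => hd u)
    (Continuous.intervalIntegrable (by fun_prop) _ _)]
  simp only [id]
  ring

lemma expWiener_add {ω : Ω} (hW : Continuous fun t => W t ω) (α : ℝ) (a b c : ℝ≥0) :
    expWiener α W a b ω + expWiener α W b c ω = expWiener α W a c ω := by
  have hc : Continuous fun u : ℝ => α * Real.exp (α * u) * W u.toNNReal ω :=
    Continuous.mul (by fun_prop) (hW.comp continuous_real_toNNReal)
  simp only [expWiener]
  rw [← intervalIntegral.integral_add_adjacent_intervals (hc.intervalIntegrable a b)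
    (hc.intervalIntegrable b c)]
  ring

variable [MeasurableSpace Ω] {P : Measure Ω}

/-- The joint law of two consecutive Wiener integrals, through linear combinations. -/
lemma hasLaw_expWiener_add [IsProbabilityMeasure P] (hW : IsBrownianReal W P) (hα : 0 < α)
    (p q : ℝ) {s t : ℝ≥0} (hst : s ≤ t) :
    HasLaw (fun ω => p * expWiener α W 0 s ω + q * expWiener α W s t ω)
      (gaussianReal 0 (p ^ 2 * ((Real.exp (2 * α * s) - 1) / (2 * α)) +
        q ^ 2 * ((Real.exp (2 * α * t) - Real.exp (2 * α * s)) / (2 * α))).toNNReal) P := by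
  have hs0 : (0 : ℝ) ≤ s := s.2
  have hst' : (s : ℝ) ≤ t := hst
  -- The disjoint union indexes both partitions at once, so that all increments on [0, s] and [s, t]
  -- form one non-overlapping family.
  let c : ∀ n, Fin n ⊕ Fin n → ℝ := fun n => Sum.elim
    (fun k => p * Real.exp (α * partitionPoint 0 s n k))
    (fun k => q * Real.exp (α * partitionPoint s t n k))
  let a : ∀ n, Fin n ⊕ Fin n → ℝ≥0 := fun n => Sum.elim
    (fun k => (partitionPoint 0 s n k).toNNReal) (fun k => (partitionPoint s t n k).toNNReal)
  let b : ∀ n, Fin n ⊕ Fin n → ℝ≥0 := fun n => Sum.elim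
    (fun k => (partitionPoint 0 s n (k + 1)).toNNReal)
    (fun k => (partitionPoint s t n (k + 1)).toNNReal)
  have m1 : ∀ n, Monotone fun k => (partitionPoint 0 s n k).toNNReal := fun n _ _ h =>
    Real.toNNReal_mono (partitionPoint_mono hs0 n h)
  have m2 : ∀ n, Monotone fun k => (partitionPoint s t n k).toNNReal := fun n _ _ h =>
    Real.toNNReal_mono (partitionPoint_mono hst' n h)
  have hlt : ∀ {n : ℕ} (u : ℕ → ℝ≥0), Monotone u → ∀ i j : Fin n, i ≠ j →
      u (i + 1) ≤ u j ∨ u (j + 1) ≤ u i := fun u hu i j hij => by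
    rcases lt_or_gt_of_ne (Fin.val_ne_of_ne hij) with h | h
    · exact Or.inl (hu h)
    · exact Or.inr (hu h)
  have hsep : ∀ {n : ℕ} (i j : Fin n),
      (partitionPoint 0 s n (i + 1)).toNNReal ≤ (partitionPoint s t n j).toNNReal := by
    intro n i j
    have hn : n ≠ 0 := (Nat.zero_le _).trans_lt i.2 |>.ne'
    refine Real.toNNReal_mono ?_
    calc partitionPoint 0 s n (i + 1) ≤ partitionPoint 0 s n n := partitionPoint_mono hs0 n i.2
      _ = partitionPoint s t n 0 := by rw [partitionPoint_self _ _ hn, partitionPoint_zero]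
      _ ≤ _ := partitionPoint_mono hst' n (Nat.zero_le _)
  have hlaw := fun n => hasLaw_sum_increments hW.toIsPreBrownianReal (c n) (a n) (b n)
    (by
      rintro (k | k)
      · exact m1 n (Nat.le_succ _)
      · exact m2 n (Nat.le_succ _))
    (by
      rintro (i | i) (j | j) hij
      · exact hlt _ (m1 n) i j (fun h => hij (by rw [h]))
      · exact Or.inl (hsep i j)
      · exact Or.inr (hsep j i)
      · exact hlt _ (m2 n) i j (fun h => hij (by rw [h])))
  refine hasLaw_gaussianReal_of_tendsto_ae hlaw ?_ ?_
  · filter_upwards [hW.cont] with ω hω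
    have h1 := (tendsto_sum_exp_increments hω α (zero_le (a := s))).const_mul p
    have h2 := (tendsto_sum_exp_increments hω α hst).const_mul q
    refine (h1.add h2).congr fun n => ?_
    simp [c, a, b, Fintype.sum_sum_type, Finset.mul_sum, mul_assoc]
  · refine (continuous_real_toNNReal.tendsto _).comp ?_
    have h1 := (tendsto_sum_exp_sq hα hs0).const_mul (p ^ 2)
    have h2 := (tendsto_sum_exp_sq hα hst').const_mul (q ^ 2)
    rw [mul_zero, Real.exp_zero] at h1
    refine (h1.add h2).congr fun n => ?_
    have n1 : ∀ k, 0 ≤ partitionPoint 0 s n k := fun k => by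
      simpa [partitionPoint_zero] using partitionPoint_mono hs0 n (Nat.zero_le k)
    have n2 : ∀ k, 0 ≤ partitionPoint s t n k := fun k =>
      hs0.trans (by simpa [partitionPoint_zero] using partitionPoint_mono hst' n (Nat.zero_le k))
    simp [c, a, b, Fintype.sum_sum_type, Finset.mul_sum, mul_assoc, mul_pow, n1, n2]

/-! ### Gaussian law of the process and product moments of the skew -/

lemma IsOrnsteinUhlenbeck.ae_eq_expWiener (hW : IsBrownianReal W P)
    (hX : IsOrnsteinUhlenbeck P α ε W X) :
    ∀ᵐ ω ∂P, ∀ t : ℝ≥0, X t ω = ε * Real.exp (-α * t) * expWiener α W 0 t ω := by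
  filter_upwards [hX.cont, hX.init, hX.sde, hW.cont, hW.eval_zero_ae_eq_zero]
    with ω h1 h2 h3 h4 h5 t
  have := eq_variation_of_constants (x := fun u => X u.toNNReal ω) (w := fun u => W u.toNNReal ω)
    (α := α) (ε := ε) (h1.comp continuous_real_toNNReal) (h4.comp continuous_real_toNNReal) t.2
    (fun u hu => by
      have := h3 u.toNNReal
      rw [h2, h5, Real.coe_toNNReal u hu] at this
      simpa using this)
  simpa [expWiener, h5] using this

/-- Splitting the integral over [0, t] at s turns the sum into a combination of two Wiener integrals
over consecutive intervals. This one-dimensional law suffices for all second moments of the skew. -/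
lemma IsOrnsteinUhlenbeck.hasLaw_add [IsProbabilityMeasure P] (hα : 0 < α)
    (hW : IsBrownianReal W P) (hX : IsOrnsteinUhlenbeck P α ε W X) {s t : ℝ≥0} (hst : s ≤ t) :
    HasLaw (fun ω => X s ω + X t ω)
      (gaussianReal 0 (ouCov α ε s s + ouCov α ε t t + 2 * ouCov α ε s t).toNNReal) P := by
  have h := hasLaw_expWiener_add hW hα (ε * (Real.exp (-α * s) + Real.exp (-α * t)))
    (ε * Real.exp (-α * t)) hst
  have hst' : (s : ℝ) ≤ t := hst
  have hvar : (ε * (Real.exp (-α * s) + Real.exp (-α * t))) ^ 2 *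
        ((Real.exp (2 * α * s) - 1) / (2 * α)) +
      (ε * Real.exp (-α * t)) ^ 2 * ((Real.exp (2 * α * t) - Real.exp (2 * α * s)) / (2 * α)) =
      ouCov α ε s s + ouCov α ε t t + 2 * ouCov α ε s t := by
    simp only [ouCov, sub_self, abs_zero, mul_zero, Real.exp_zero,
      abs_of_nonneg (sub_nonneg.mpr hst')]
    have e1 : Real.exp (2 * α * s) = (Real.exp (-α * s))⁻¹ ^ 2 := by
      rw [← Real.exp_neg, ← Real.exp_nat_mul]; congr 1; push_cast; ring
    have e2 : Real.exp (2 * α * t) = (Real.exp (-α * t))⁻¹ ^ 2 := by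
      rw [← Real.exp_neg, ← Real.exp_nat_mul]; congr 1; push_cast; ring
    have e3 : Real.exp (-α * (t - s)) = Real.exp (-α * t) * (Real.exp (-α * s))⁻¹ := by
      rw [← Real.exp_neg, ← Real.exp_add]; congr 1; ring
    have e4 : ∀ x y : ℝ, Real.exp (-α * (x + y)) = Real.exp (-α * x) * Real.exp (-α * y) :=
      fun x y => by rw [← Real.exp_add]; congr 1; ring
    rw [e1, e2, e3, e4, e4, e4]
    have := (Real.exp_pos (-α * s)).ne'
    have := (Real.exp_pos (-α * t)).ne'
    field_simp
    ring
  rw [hvar] at h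
  refine h.congr ?_
  filter_upwards [hX.ae_eq_expWiener hW, hW.cont] with ω h1 h2
  rw [h1, h1, ← expWiener_add h2 α 0 s t]
  ring

lemma IsOrnsteinUhlenbeck.aemeasurable [IsProbabilityMeasure P] (hα : 0 < α)
    (hW : IsBrownianReal W P) (hX : IsOrnsteinUhlenbeck P α ε W X) (t : ℝ≥0) :
    AEMeasurable (X t) P := by
  -- Take s = 0, where X vanishes almost surely.
  refine (hX.hasLaw_add hα hW (zero_le (a := t))).aemeasurable.congr ?_
  filter_upwards [hX.init] with ω h
  rw [h, zero_add]

/-- The product is a constant times the exponential of a centered Gaussian of variance K(s, s) +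
K(t, t) + 2K(s, t); half this variance, minus the halves of the diagonal terms from c, leaves K(s,
t). -/
lemma IsOrnsteinUhlenbeck.integrable_skew_mul_skew [IsProbabilityMeasure P] (hα : 0 < α)
    (hW : IsBrownianReal W P) (hX : IsOrnsteinUhlenbeck P α ε W X) (s t : ℝ≥0) :
    Integrable (fun ω => skew α ε X s ω * skew α ε X t ω) P ∧
      ∫ ω, skew α ε X s ω * skew α ε X t ω ∂P = Real.exp (ouCov α ε s t) := by
  wlog hst : s ≤ t generalizing s t
  · simp_rw [mul_comm (skew α ε X s _), ouCov_comm α ε s]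
    exact this t s (le_of_not_ge hst)
  have hlaw := hX.hasLaw_add hα hW hst
  have heq : (fun ω => skew α ε X s ω * skew α ε X t ω) = fun ω =>
      normFactor α ε s * normFactor α ε t * Real.exp (1 * (X s ω + X t ω)) := by
    ext ω
    rw [skew, skew, one_mul, Real.exp_add]
    ring
  have hv : 0 ≤ ouCov α ε s s + ouCov α ε t t + 2 * ouCov α ε s t := by
    have := ouCov_nonneg hα ε s.2 s.2
    have := ouCov_nonneg hα ε t.2 t.2
    have := ouCov_nonneg hα ε s.2 t.2
    simp only [NNReal.val_eq_coe] at *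
    linarith
  rw [heq]
  constructor
  · refine Integrable.const_mul ?_ _
    have := integrable_exp_mul_gaussianReal (μ := 0)
      (v := (ouCov α ε s s + ouCov α ε t t + 2 * ouCov α ε s t).toNNReal) 1
    rw [← hlaw.map_eq] at this
    exact this.comp_aemeasurable hlaw.aemeasurable
  · rw [integral_const_mul]
    have := mgf_gaussianReal hlaw.map_eq 1
    rw [mgf, Real.coe_toNNReal _ hv] at this
    rw [this, normFactor_eq hα, normFactor_eq hα, ← Real.exp_add, ← Real.exp_add]
    congr 1
    ring

end ClockModel

/-! ### Joint measurability, and moments of skew and display -/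

/-- A process with almost surely continuous paths is jointly measurable up to null sets. -/
lemma aestronglyMeasurable_uncurry_of_ae_continuous {Ω β : Type*} [MeasurableSpace Ω]
    [MeasurableSpace β] {P : Measure Ω} [SFinite P] {ν : Measure β} [SFinite ν]
    {Y : ℝ≥0 → Ω → ℝ} (hY : ∀ t, AEMeasurable (Y t) P)
    (hc : ∀ᵐ ω ∂P, Continuous fun t => Y t ω) {g : β → ℝ≥0} (hg : Measurable g) :
    AEStronglyMeasurable (fun z : β × Ω => Y (g z.1) z.2) (ν.prod P) := by
  have hsnd : Measure.QuasiMeasurePreserving (Prod.snd : β × Ω → Ω) (ν.prod P) P :=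
    Measure.quasiMeasurePreserving_snd
  -- Rounding time down to a grid of mesh 1/n leaves countably many times, so the null sets where Y
  -- differs from measurable versions can be discarded together.
  let q : ℕ → ℕ → ℝ≥0 := fun n k => ((k : ℝ) / n).toNNReal
  let fl : ℕ → β → ℕ := fun n x => ⌊(g x : ℝ) * n⌋₊
  refine aestronglyMeasurable_of_tendsto_ae atTop
    (f := fun n (z : β × Ω) => Y (q n (fl n z.1)) z.2) (fun n => ?_) ?_
  · have hfl : Measurable (fl n) :=
      Nat.measurable_floor.comp (hg.coe_nnreal_real.mul_const _)
    have hm : Measurable fun y : ℕ × Ω => (hY (q n y.1)).mk _ y.2 :=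
      measurable_from_prod_countable_right fun k => (hY (q n k)).measurable_mk
    refine ⟨fun z => (hY (q n (fl n z.1))).mk _ z.2,
      (hm.comp ((hfl.comp measurable_fst).prodMk measurable_snd)).stronglyMeasurable, ?_⟩
    have hall : ∀ᵐ ω ∂P, ∀ k, Y (q n k) ω = (hY (q n k)).mk _ ω :=
      ae_all_iff.mpr fun k => (hY (q n k)).ae_eq_mk
    filter_upwards [hsnd.ae hall] with z hz using hz _
  · filter_upwards [hsnd.ae hc] with z hz
    refine (hz.tendsto (g z.1)).comp ?_
    have h := (tendsto_nat_floor_mul_div_atTop (R := ℝ) (a := g z.1) (g z.1).2).comp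
      tendsto_natCast_atTop_atTop
    have := (continuous_real_toNNReal.tendsto _).comp h
    rwa [Real.toNNReal_coe] at this

namespace ClockModel

lemma skew_pos {Ω : Type*} (α ε : ℝ) (X : ℝ≥0 → Ω → ℝ) (t : ℝ≥0) (ω : Ω) :
    0 < skew α ε X t ω := mul_pos (Real.exp_pos _) (Real.exp_pos _)

lemma display_eq_setIntegral {Ω : Type*} (α ε : ℝ) (X : ℝ≥0 → Ω → ℝ) (t : ℝ≥0) (ω : Ω) :
    display α ε X t ω = ∫ s in Set.Ioc 0 (t : ℝ), skew α ε X s.toNNReal ω := by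
  rw [display, intervalIntegral.integral_of_le t.coe_nonneg]

variable {Ω : Type*} [MeasurableSpace Ω] {P : Measure Ω} {W X : ℝ≥0 → Ω → ℝ} {α ε : ℝ}

lemma IsOrnsteinUhlenbeck.continuous_skew (hX : IsOrnsteinUhlenbeck P α ε W X) :
    ∀ᵐ ω ∂P, Continuous fun t => skew α ε X t ω := by
  filter_upwards [hX.cont] with ω h
  unfold skew normFactor
  fun_prop

lemma IsOrnsteinUhlenbeck.skew_zero (hX : IsOrnsteinUhlenbeck P α ε W X) :
    skew α ε X 0 =ᵐ[P] fun _ => 1 := by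
  filter_upwards [hX.init] with ω h
  simp [skew, normFactor, h]

section

variable [IsProbabilityMeasure P] (hα : 0 < α) (hW : IsBrownianReal W P) (hX : IsOrnsteinUhlenbeck P α ε W X)
include hα hW hX

lemma IsOrnsteinUhlenbeck.aemeasurable_skew (t : ℝ≥0) : AEMeasurable (skew α ε X t) P :=
  (Real.measurable_exp.comp_aemeasurable (hX.aemeasurable hα hW t)).const_mul _

lemma IsOrnsteinUhlenbeck.memLp_skew (t : ℝ≥0) : MemLp (skew α ε X t) 2 P := by
  rw [memLp_two_iff_integrable_sq (hX.aemeasurable_skew hα hW t).aestronglyMeasurable]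
  simpa only [sq] using (hX.integrable_skew_mul_skew hα hW t t).1

lemma IsOrnsteinUhlenbeck.integral_skew (t : ℝ≥0) : ∫ ω, skew α ε X t ω ∂P = 1 := by
  -- The mean is the product moment with time 0, where the skew is 1.
  have h := (hX.integrable_skew_mul_skew hα hW 0 t).2
  have h0 : ouCov α ε (0 : ℝ≥0) t = 0 := by
    simp [ouCov]
  rw [h0, Real.exp_zero] at h
  rw [← h]
  refine integral_congr_ae ?_
  filter_upwards [hX.skew_zero] with ω hω
  rw [hω, one_mul]

lemma IsOrnsteinUhlenbeck.variance_skew (t : ℝ≥0) :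
    variance (skew α ε X t) P = Real.exp (ouCov α ε t t) - 1 := by
  rw [variance_eq_sub (hX.memLp_skew hα hW t), hX.integral_skew hα hW,
    ← (hX.integrable_skew_mul_skew hα hW t t).2]
  simp [sq]

lemma IsOrnsteinUhlenbeck.integrable_skew_prod {μ : Measure ℝ} [IsFiniteMeasure μ] :
    Integrable (fun z : ℝ × Ω => skew α ε X z.1.toNNReal z.2) (μ.prod P) := by
  have hmeas : AEStronglyMeasurable (fun z : ℝ × Ω => skew α ε X z.1.toNNReal z.2) (μ.prod P) :=
    aestronglyMeasurable_uncurry_of_ae_continuous (Y := skew α ε X) (g := Real.toNNReal)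
      (hX.aemeasurable_skew hα hW) hX.continuous_skew measurable_real_toNNReal
  have hs : ∀ s : ℝ, Integrable (skew α ε X s.toNNReal) P := fun s =>
    (hX.memLp_skew hα hW s.toNNReal).integrable one_le_two
  have hn : ∀ s : ℝ, ∫ ω, ‖skew α ε X s.toNNReal ω‖ ∂P = 1 := fun s => by
    simp_rw [Real.norm_of_nonneg (skew_pos α ε X _ _).le]
    exact hX.integral_skew hα hW _
  refine (integrable_prod_iff hmeas).mpr ⟨ae_of_all _ hs, ?_⟩
  simp_rw [hn]
  exact integrable_const (1 : ℝ)

lemma IsOrnsteinUhlenbeck.integral_display (t : ℝ≥0) : ∫ ω, display α ε X t ω ∂P = t := by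
  simp_rw [display_eq_setIntegral]
  rw [integral_integral_swap (f := fun ω (s : ℝ) => skew α ε X s.toNNReal ω)
    (hX.integrable_skew_prod hα hW).swap]
  simp_rw [hX.integral_skew hα hW]
  simp

lemma IsOrnsteinUhlenbeck.aestronglyMeasurable_display (t : ℝ≥0) :
    AEStronglyMeasurable (display α ε X t) P := by
  refine AEStronglyMeasurable.congr (Integrable.integral_prod_right
    (hX.integrable_skew_prod (μ := volume.restrict (Set.Ioc 0 (t : ℝ))) hα hW)).aestronglyMeasurable
    (ae_of_all _ fun ω => ?_)
  rw [display_eq_setIntegral]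

/-- The square of the time integral is a double time integral; positivity of the skew and
boundedness of e^K justify exchanging it with the expectation. -/
lemma IsOrnsteinUhlenbeck.integral_display_sq (t : ℝ≥0) :
    Integrable (fun ω => display α ε X t ω ^ 2) P ∧
      ∫ ω, display α ε X t ω ^ 2 ∂P =
        ∫ s in Set.Ioc 0 (t : ℝ), ∫ r in Set.Ioc 0 (t : ℝ), Real.exp (ouCov α ε s r) := by
  set μ : Measure ℝ := volume.restrict (Set.Ioc 0 (t : ℝ)) with hμ
  have hY := hX.aemeasurable_skew hα hW
  have hK : Integrable (fun z : ℝ × ℝ => Real.exp (ouCov α ε z.1.toNNReal z.2.toNNReal))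
      (μ.prod μ) := by
    refine Integrable.of_bound (C := Real.exp (ε ^ 2 / (2 * α))) ?_ (ae_of_all _ fun z => ?_)
    · exact (Real.continuous_exp.comp ((continuous_ouCov α ε).comp
        (f := fun z : ℝ × ℝ => ((z.1.toNNReal : ℝ), (z.2.toNNReal : ℝ)))
        (by fun_prop))).aestronglyMeasurable
    · rw [Real.norm_of_nonneg (Real.exp_pos _).le]
      exact Real.exp_le_exp.mpr (ouCov_le hα _ _ _)
  have hm1 : AEStronglyMeasurable (fun z : (ℝ × ℝ) × Ω => skew α ε X z.1.1.toNNReal z.2)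
      ((μ.prod μ).prod P) :=
    aestronglyMeasurable_uncurry_of_ae_continuous (Y := skew α ε X)
      (g := fun z : ℝ × ℝ => z.1.toNNReal) hY hX.continuous_skew (by fun_prop)
  have hm2 : AEStronglyMeasurable (fun z : (ℝ × ℝ) × Ω => skew α ε X z.1.2.toNNReal z.2)
      ((μ.prod μ).prod P) :=
    aestronglyMeasurable_uncurry_of_ae_continuous (Y := skew α ε X)
      (g := fun z : ℝ × ℝ => z.2.toNNReal) hY hX.continuous_skew (by fun_prop)
  have hint : Integrable (fun z : (ℝ × ℝ) × Ω =>
      skew α ε X z.1.1.toNNReal z.2 * skew α ε X z.1.2.toNNReal z.2) ((μ.prod μ).prod P) := by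
    refine (integrable_prod_iff (hm1.mul hm2)).mpr
      ⟨ae_of_all _ fun z => (hX.integrable_skew_mul_skew hα hW z.1.toNNReal z.2.toNNReal).1, ?_⟩
    simp_rw [Pi.mul_apply, Real.norm_of_nonneg
      (mul_pos (skew_pos α ε X _ _) (skew_pos α ε X _ _)).le,
      (hX.integrable_skew_mul_skew hα hW _ _).2]
    exact hK
  have hdisp : (fun ω => display α ε X t ω ^ 2) = fun ω =>
      ∫ z : ℝ × ℝ, skew α ε X z.1.toNNReal ω * skew α ε X z.2.toNNReal ω ∂(μ.prod μ) := by
    ext ω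
    rw [integral_prod_mul (fun s : ℝ => skew α ε X s.toNNReal ω)
      (fun s : ℝ => skew α ε X s.toNNReal ω), display_eq_setIntegral, sq]
  rw [hdisp]
  refine ⟨hint.integral_prod_right, ?_⟩
  rw [integral_integral_swap (f := fun ω (z : ℝ × ℝ) =>
    skew α ε X z.1.toNNReal ω * skew α ε X z.2.toNNReal ω) hint.swap]
  simp_rw [(hX.integrable_skew_mul_skew hα hW _ _).2]
  rw [integral_prod _ hK]
  refine setIntegral_congr_fun measurableSet_Ioc fun s hs =>
    setIntegral_congr_fun measurableSet_Ioc fun r hr => ?_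
  simp only [Real.coe_toNNReal _ hs.1.le, Real.coe_toNNReal _ hr.1.le]

lemma IsOrnsteinUhlenbeck.memLp_display (t : ℝ≥0) : MemLp (display α ε X t) 2 P :=
  (memLp_two_iff_integrable_sq (hX.aestronglyMeasurable_display hα hW t)).mpr
    (hX.integral_display_sq hα hW t).1

lemma IsOrnsteinUhlenbeck.variance_display (t : ℝ≥0) :
    variance (display α ε X t) P =
      (∫ s in Set.Ioc 0 (t : ℝ), ∫ r in Set.Ioc 0 (t : ℝ), Real.exp (ouCov α ε s r)) - t ^ 2 := by
  rw [variance_eq_sub (hX.memLp_display hα hW t), hX.integral_display hα hW t,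
    ← (hX.integral_display_sq hα hW t).2]
  rfl

end

/-! ### Deterministic bounds on the covariance integrals -/

lemma integral_exp_ouCov_le (hα : 0 < α) (ε : ℝ) (t : ℝ≥0) :
    ∫ s in Set.Ioc 0 (t : ℝ), ∫ r in Set.Ioc 0 (t : ℝ), Real.exp (ouCov α ε s r) ≤
      Real.exp (ε ^ 2 / (2 * α)) * t ^ 2 := by
  have hb : ∀ s r, ‖Real.exp (ouCov α ε s r)‖ ≤ Real.exp (ε ^ 2 / (2 * α)) := fun s r => by
    rw [Real.norm_of_nonneg (Real.exp_pos _).le]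
    exact Real.exp_le_exp.mpr (ouCov_le hα _ _ _)
  have hvol : (volume : Measure ℝ).real (Set.Ioc 0 (t : ℝ)) = t := by simp
  have hfin : (volume : Measure ℝ) (Set.Ioc 0 (t : ℝ)) < ⊤ := measure_Ioc_lt_top
  have h1 : ∀ s : ℝ, ‖∫ r in Set.Ioc 0 (t : ℝ), Real.exp (ouCov α ε s r)‖ ≤
      Real.exp (ε ^ 2 / (2 * α)) * t := fun s => by
    have := norm_setIntegral_le_of_norm_le_const hfin fun r _ => hb s r
    rwa [hvol] at this
  have h2 := norm_setIntegral_le_of_norm_le_const hfin fun s _ => h1 s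
  rw [hvol] at h2
  refine (Real.le_norm_self _).trans (h2.trans_eq (by ring))

/-- As K ≥ 0, integration can be restricted to r ≤ s, where the absolute value disappears and the
integral is explicit. -/
lemma le_integral_ouCov (hα : 0 < α) (ε : ℝ) {s t : ℝ} (hs : 0 ≤ s) (hst : s ≤ t) :
    ε ^ 2 / (2 * α ^ 2) * (1 - 2 * Real.exp (-α * s)) ≤
      ∫ r in Set.Ioc 0 t, ouCov α ε s r := by
  have hc : Continuous fun r => ouCov α ε s r :=
    (continuous_ouCov α ε).comp (f := fun r => (s, r)) (by fun_prop)
  have hint : IntegrableOn (fun r => ouCov α ε s r) (Set.Ioc 0 t) :=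
    (hc.integrableOn_Icc).mono_set Set.Ioc_subset_Icc_self
  have h1 : ∫ r in Set.Ioc 0 s, ouCov α ε s r ≤ ∫ r in Set.Ioc 0 t, ouCov α ε s r := by
    refine setIntegral_mono_set hint ?_ (Set.Ioc_subset_Ioc_right hst).eventuallyLE
    filter_upwards [ae_restrict_mem measurableSet_Ioc] with r hr
    exact ouCov_nonneg hα ε hs hr.1.le
  refine le_trans ?_ h1
  have hd : ∀ r : ℝ, HasDerivAt (fun r => ε ^ 2 / (2 * α ^ 2) *
      (Real.exp (α * r) * Real.exp (-α * s) + Real.exp (-α * r) * Real.exp (-α * s)))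
      (ε ^ 2 / (2 * α) * (Real.exp (-α * (s - r)) - Real.exp (-α * (r + s)))) r := fun r => by
    refine ((((hasDerivAt_exp_mul α r).mul_const _).add
      ((hasDerivAt_exp_mul (-α) r).mul_const _)).const_mul _).congr_deriv ?_
    rw [show -α * (s - r) = α * r + -α * s by ring, mul_add (-α) r s, Real.exp_add, Real.exp_add]
    field_simp
    ring
  have h2 : ∫ r in Set.Ioc 0 s, ouCov α ε s r =
      ∫ r in (0 : ℝ)..s, ε ^ 2 / (2 * α) *
        (Real.exp (-α * (s - r)) - Real.exp (-α * (r + s))) := by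
    rw [intervalIntegral.integral_of_le hs]
    refine setIntegral_congr_fun measurableSet_Ioc fun r hr => ?_
    simp only [ouCov]
    rw [abs_sub_comm, abs_of_nonneg (by linarith [hr.2])]
  rw [h2, intervalIntegral.integral_eq_sub_of_hasDerivAt (fun r _ => hd r)
    (Continuous.intervalIntegrable (by fun_prop) _ _), ← mul_sub]
  refine mul_le_mul_of_nonneg_left ?_ (by positivity)
  have e : Real.exp (α * s) * Real.exp (-α * s) = 1 := by rw [← Real.exp_add]; simp
  rw [e]
  simp only [mul_zero, Real.exp_zero]
  -- The exact bracket is 1 + e^{-2αs} - 2e^{-αs}; the square is dropped.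
  nlinarith [sq_nonneg (Real.exp (-α * s))]

lemma le_integral_exp_ouCov (hα : 0 < α) (ε : ℝ) (t : ℝ≥0) :
    (t : ℝ) ^ 2 + ε ^ 2 / (2 * α ^ 2) * (t - 2 / α) ≤
      ∫ s in Set.Ioc 0 (t : ℝ), ∫ r in Set.Ioc 0 (t : ℝ), Real.exp (ouCov α ε s r) := by
  have hexp : Continuous fun z : ℝ × ℝ => Real.exp (ouCov α ε z.1 z.2) :=
    Real.continuous_exp.comp (continuous_ouCov α ε)
  have hI : ∀ {f : ℝ → ℝ}, Continuous f → IntegrableOn f (Set.Ioc 0 (t : ℝ)) := fun hf =>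
    (hf.integrableOn_Icc).mono_set Set.Ioc_subset_Icc_self
  have hinner : ∀ s ∈ Set.Ioc 0 (t : ℝ), t + ε ^ 2 / (2 * α ^ 2) * (1 - 2 * Real.exp (-α * s)) ≤
      ∫ r in Set.Ioc 0 (t : ℝ), Real.exp (ouCov α ε s r) := fun s hs => by
    have hc : Continuous fun r => ouCov α ε s r :=
      (continuous_ouCov α ε).comp (f := fun r => (s, r)) (by fun_prop)
    calc _ ≤ t + ∫ r in Set.Ioc 0 (t : ℝ), ouCov α ε s r := by
          gcongr
          exact le_integral_ouCov hα ε hs.1.le hs.2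
      _ = ∫ r in Set.Ioc 0 (t : ℝ), (1 + ouCov α ε s r) := by
          rw [integral_add (hI continuous_const) (hI hc)]
          simp
      _ ≤ _ := by
          refine setIntegral_mono (hI (by fun_prop)) (hI (by fun_prop)) fun r => ?_
          linarith [Real.add_one_le_exp (ouCov α ε s r)]
  have hcont : Continuous fun s => ∫ r in Set.Ioc 0 (t : ℝ), Real.exp (ouCov α ε s r) := by
    simp_rw [← intervalIntegral.integral_of_le t.coe_nonneg]
    exact intervalIntegral.continuous_parametric_intervalIntegral_of_continuous' hexp _ _
  refine le_trans ?_ (setIntegral_mono_on (hI (by fun_prop)) (hI hcont) measurableSet_Ioc hinner)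
  rw [← intervalIntegral.integral_of_le t.coe_nonneg, intervalIntegral.integral_eq_sub_of_hasDerivAt
    (f := fun s => t * s + ε ^ 2 / (2 * α ^ 2) * (s + 2 / α * Real.exp (-α * s)))
    (fun s _ => ?_) (Continuous.intervalIntegrable (by fun_prop) _ _)]
  · simp only [mul_zero, Real.exp_zero, mul_one, zero_add]
    have h1 : 0 ≤ ε ^ 2 / (2 * α ^ 2) * (2 / α * Real.exp (-α * t)) := by positivity
    -- The boundary term (2/α) e^{-αt} is nonnegative and is dropped.
    nlinarith
  · refine (((hasDerivAt_id s).const_mul (t : ℝ)).add (((hasDerivAt_id s).add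
      ((hasDerivAt_exp_mul (-α) s).const_mul (2 / α))).const_mul _)).congr_deriv ?_
    field_simp
    ring

end ClockModel

/-! ### Assembly -/

theorem lemma1 {Ω : Type*} [MeasurableSpace Ω] (P : Measure Ω) [IsProbabilityMeasure P]
    {n : ℕ} (α ε : Fin n → ℝ) (W X : Fin n → ℝ≥0 → Ω → ℝ)
    (h : ClockModel.IsClockNetwork P α ε W X) (i : Fin n) :
    -- the skew: finite second moments, mean one, uniformly bounded variance
    ((∀ t, MemLp (ClockModel.skew (α i) (ε i) (X i) t) 2 P) ∧
      (∀ t, ∫ ω, ClockModel.skew (α i) (ε i) (X i) t ω ∂P = 1) ∧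
      BddAbove (Set.range fun t => variance (ClockModel.skew (α i) (ε i) (X i) t) P)) ∧
    -- the display: well defined, finite second moments, mean `t`, growth of the variance
    ((∀ᵐ ω ∂P, ∀ t : ℝ≥0, IntervalIntegrable
        (fun s : ℝ => ClockModel.skew (α i) (ε i) (X i) s.toNNReal ω) volume 0 (t : ℝ)) ∧
      (∀ t, MemLp (ClockModel.display (α i) (ε i) (X i) t) 2 P) ∧
      (∀ t : ℝ≥0, ∫ ω, ClockModel.display (α i) (ε i) (X i) t ω ∂P = (t : ℝ)) ∧
      Tendsto (fun t : ℝ≥0 => variance (ClockModel.display (α i) (ε i) (X i) t) P)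
        atTop atTop ∧
      (fun t : ℝ≥0 => (t : ℝ)) =O[atTop]
        (fun t : ℝ≥0 => variance (ClockModel.display (α i) (ε i) (X i) t) P) ∧
      (fun t : ℝ≥0 => variance (ClockModel.display (α i) (ε i) (X i) t) P) =O[atTop]
        (fun t : ℝ≥0 => (t : ℝ) ^ 2)) := by
  have hα := h.alpha_pos i
  have hε := h.eps_pos i
  have hW := h.brownian i
  have hX := h.ou i
  set κ : ℝ := ε i ^ 2 / (2 * α i ^ 2) with hκ
  have hκ0 : 0 < κ := by positivity
  have hlow : ∀ t : ℝ≥0, κ * (t - 2 / α i) ≤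
      variance (ClockModel.display (α i) (ε i) (X i) t) P := fun t => by
    rw [hX.variance_display hα hW]
    linarith [ClockModel.le_integral_exp_ouCov hα (ε i) t]
  refine ⟨⟨hX.memLp_skew hα hW, hX.integral_skew hα hW, ?_⟩, ?_, hX.memLp_display hα hW,
    hX.integral_display hα hW, ?_, ?_, ?_⟩
  · refine ⟨Real.exp (ε i ^ 2 / (2 * α i)) - 1, ?_⟩
    rintro _ ⟨t, rfl⟩
    simp only [hX.variance_skew hα hW]
    gcongr
    exact ClockModel.ouCov_le hα _ _ _
  · filter_upwards [hX.continuous_skew] with ω hω t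
    exact (hω.comp continuous_real_toNNReal).intervalIntegrable _ _
  · refine tendsto_atTop_mono hlow (Tendsto.const_mul_atTop hκ0 ?_)
    exact tendsto_atTop_add_const_right _ _ (NNReal.tendsto_coe_atTop.mpr tendsto_id)
  · refine IsBigO.of_bound (2 / κ) ?_
    -- From t = 4/α on, 2/α ≤ t/2, so the variance is at least κt/2; hence the constant 2/κ.
    have hev : ∀ᶠ t : ℝ≥0 in atTop, 4 / α i ≤ (t : ℝ) :=
      (NNReal.tendsto_coe_atTop.mpr tendsto_id).eventually_ge_atTop _
    filter_upwards [hev] with t ht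
    rw [Real.norm_of_nonneg t.coe_nonneg, Real.norm_of_nonneg (variance_nonneg _ _), div_mul_eq_mul_div,
      le_div_iff₀ hκ0]
    have : 4 / α i = 2 * (2 / α i) := by ring
    nlinarith [hlow t]
  · refine IsBigO.of_bound (Real.exp (ε i ^ 2 / (2 * α i))) (Eventually.of_forall fun t => ?_)
    rw [Real.norm_of_nonneg (variance_nonneg _ _), Real.norm_of_nonneg (sq_nonneg _),
      hX.variance_display hα hW]
    linarith [ClockModel.integral_exp_ouCov_le hα (ε i) t, sq_nonneg (t : ℝ)]
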